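/- Let $\mathrm{Diff}_+(S^1)$ be the group of orientation preserving $C^\infty$ diffeomorphisms of the unit circle; a point of $S^1\backslash\mathrm{Diff}_+(S^1)$ (quotient by rotations acting on the left) is represented by an element $\gamma\in\mathrm{Diff}_+(S^1)$, for instance the one with $\gamma(1)=1$. For functions on $S^1$ let a prime or an exponent $(k)$ denote differentiation with respect to $z=e^{i\theta}$, that is $\frac{d}{dz}=\frac{1}{ie^{i\theta}}\frac{d}{d\theta}$, and let $$\mathcal S(\gamma)=\frac{\gamma'''}{\gamma'}-\frac32\left(\frac{\gamma''}{\gamma'}\right)^2 .$$ Let $n\ge 1$ be an integer. There are functions $\xi[\gamma;n]_m$, $2\le m\le 2n-1$, on $S^1$, polynomials with complex coefficients in $\mathcal S(\gamma),\mathcal S(\gamma)',\mathcal S(\gamma)'',\dots$, such that $$\left(h\circ\gamma\,(\gamma')^{1-n}\right)^{(2n-1)}=h^{(2n-1)}\circ\gamma\,(\gamma')^{n}-\sum_{m=2}^{2n-1}\xi[\gamma;n]_m\left(h\circ\gamma\,(\gamma')^{1-n}\right)^{(2n-1-m)}$$ at every point of $S^1$ near whose image under $\gamma$ the function $h$ is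 holomorphic; these functions are uniquely determined. Put $\alpha_n=\frac{2^{2n-2}}{(2n-2)!\,\pi}$, and for $k\in\mathbb Z$ $$c[n]_k=\begin{cases}\sqrt{\alpha_n}\sqrt{\frac{(|k|+n-1)!}{(|k|-n)!}},&|k|\ge n,\\ \sqrt{\alpha_n},&|k|<n,\end{cases}\qquad c[1-n]_k=\frac{\alpha_n}{c[n]_k},\qquad \operatorname{sgn}_n k=\begin{cases}1,&k\ge n,\\-1,&k<n.\end{cases}$$ Define the numbers $\Xi[\gamma;n;m]_k$ by the Fourier expansion $\xi[\gamma;n]_m(e^{i\theta})=\sum_{k\in\mathbb Z}\Xi[\gamma;n;m]_k\,c[2]_k\,e^{i(k-m)\theta}$, where $c[2]_k$ is given by the above formula with $n=2$, and the $\mathbb Z\times\mathbb Z$ matrix $\mathfrak S[\gamma;n]$ by $$\mathfrak S[\gamma;n]_{lj}=(\operatorname{sgn}_n j)\sum_{m=2}^{2n-1}\Xi[\gamma;n;m]_{l-j}\,\frac{c[2]_{l-j}\,c[1-n]_j}{c[n]_l}\,(j+n-1)(j+n-2)\cdots(j-n+m+1),$$ where the last product has $2n-1-m$ factors (and is $1$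 for $m=2n-1$). Let $\mathfrak S_1[\gamma;n]=(\mathfrak S[\gamma;n]_{lk})_{l,k\ge n}$. Then, for every $\gamma\in\mathrm{Diff}_+(S^1)$ (hence for every point of $S^1\backslash\mathrm{Diff}_+(S^1)$) and every integer $n\ge1$, the matrix $\mathfrak S_1[\gamma;n]$ defines a trace class operator on $\ell^2=\ell^2(\{k\in\mathbb Z: k\ge n\})$: there is a bounded operator $T$ on $\ell^2$ with $(Tv)_l=\sum_{k\ge n}\mathfrak S_1[\gamma;n]_{lk}v_k$ for all $v\in\ell^2$, $l\ge n$, and the trace of $|T|=\sqrt{T^*T}$ is finite. -/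

import Mathlib

open scoped Manifold ContDiff ENNReal InnerProductSpace

noncomputable section

namespace CircleSchwarzian

/-! ### Calculus on the circle

A function on `S¹` is written in the angular coordinate, as the function `θ ↦ φ (e^{iθ})` on `ℝ`. -/

/-- The derivative `d/dz`, `z = e^{iθ}`, along the unit circle:
`dφ/dz = (i e^{iθ})⁻¹ dφ/dθ`. -/
def zDeriv (φ : ℝ → ℂ) : ℝ → ℂ :=
  fun θ => deriv φ θ / (Complex.I * Complex.exp (θ * Complex.I))

/-- The Schwarzian derivative `S(T) = T_zzz / T_z - (3/2) (T_zz / T_z)²` along the circle. -/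
def schwarzian (T : ℝ → ℂ) : ℝ → ℂ :=
  fun θ => zDeriv^[3] T θ / zDeriv T θ - 3 / 2 * (zDeriv^[2] T θ / zDeriv T θ) ^ 2

/-- The ring `ℂ[S(T), S(T)_z, S(T)_zz, …]` of complex polynomials in the Schwarzian derivative
of `T` and its derivatives. -/
def schwarzianRing (T : ℝ → ℂ) : Subalgebra ℂ (ℝ → ℂ) :=
  Algebra.adjoin ℂ (Set.range fun k : ℕ => zDeriv^[k] (schwarzian T))

/-- `Diff₊(S¹)`: orientation preserving smooth diffeomorphisms of the unit circle. If
`γ (e^{iθ}) = e^{iψ(θ)}` then `z γ'(z) / γ(z) = ψ'(θ)` for `z = e^{iθ}`, so the second field says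
that `γ` preserves the orientation. -/
structure DiffPlus where
  toDiffeo : Circle ≃ₘ^∞⟮𝓡 1, 𝓡 1⟯ Circle
  orientation : ∀ θ : ℝ,
    0 < (Complex.exp (θ * Complex.I) * zDeriv (fun t => (toDiffeo (Circle.exp t) : ℂ)) θ /
      (toDiffeo (Circle.exp θ) : ℂ)).re

/-- `θ ↦ γ (e^{iθ})`, as a complex valued function. -/
def DiffPlus.fn (γ : DiffPlus) : ℝ → ℂ := fun θ => (γ.toDiffeo (Circle.exp θ) : ℂ)

/-- `θ ↦ h (T (e^{iθ})) T'(e^{iθ})^{1-n}`, the pull-back of `h` as a `(1-n)`-differential. -/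
def pullback (n : ℕ) (T : ℝ → ℂ) (h : ℂ → ℂ) : ℝ → ℂ :=
  fun θ => h (T θ) * zDeriv T θ ^ (1 - (n : ℤ))

/-- `ξ₂, …, ξ_{2n-1}` are the coefficients of `T` of weight `n`: they are polynomials in the
Schwarzian derivative of `T` and its derivatives, vanish by convention for other indices, and
`(h ∘ T (T')^{1-n})^{(2n-1)} = h^{(2n-1)} ∘ T (T')^n - ∑_{m=2}^{2n-1} ξ_m (h ∘ T (T')^{1-n})^{(2n-1-m)}`
at every point of the circle near whose image `h` is holomorphic. -/
def IsSchwarzianCoeffs (n : ℕ) (T : ℝ → ℂ) (ξ : ℕ → ℝ → ℂ) : Prop :=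
  (∀ m, ξ m ∈ schwarzianRing T) ∧
  (∀ m, m ∉ Finset.Icc 2 (2 * n - 1) → ξ m = 0) ∧
  ∀ (h : ℂ → ℂ) (θ : ℝ), AnalyticAt ℂ h (T θ) →
    zDeriv^[2 * n - 1] (pullback n T h) θ =
      iteratedDeriv (2 * n - 1) h (T θ) * zDeriv T θ ^ n -
        ∑ m ∈ Finset.Icc 2 (2 * n - 1), ξ m θ * zDeriv^[2 * n - 1 - m] (pullback n T h) θ

/-! ### Existence of the coefficients -/

/-- `φ` has derivative `d` at `θ` with respect to `z = e^{iθ}`. -/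
def HasZ (φ : ℝ → ℂ) (d : ℂ) (θ : ℝ) : Prop :=
  HasDerivAt φ (d * (Complex.I * Complex.exp (θ * Complex.I))) θ

theorem iexp_ne (θ : ℝ) : Complex.I * Complex.exp (θ * Complex.I) ≠ 0 :=
  mul_ne_zero Complex.I_ne_zero (Complex.exp_ne_zero _)

theorem HasZ.zDeriv_eq {φ : ℝ → ℂ} {d : ℂ} {θ : ℝ} (h : HasZ φ d θ) : zDeriv φ θ = d := by
  unfold zDeriv
  rw [HasDerivAt.deriv h, mul_div_cancel_right₀ _ (iexp_ne θ)]

theorem hasZ_of_differentiableAt {φ : ℝ → ℂ} {θ : ℝ} (h : DifferentiableAt ℝ φ θ) :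
    HasZ φ (zDeriv φ θ) θ := by
  unfold HasZ zDeriv
  rw [div_mul_cancel₀ _ (iexp_ne θ)]
  exact h.hasDerivAt

theorem HasZ.add {φ ψ : ℝ → ℂ} {d e : ℂ} {θ : ℝ} (h : HasZ φ d θ) (k : HasZ ψ e θ) :
    HasZ (fun t => φ t + ψ t) (d + e) θ := by
  unfold HasZ at *
  rw [add_mul]
  exact HasDerivAt.fun_add h k

theorem HasZ.mul {φ ψ : ℝ → ℂ} {d e : ℂ} {θ : ℝ} (h : HasZ φ d θ) (k : HasZ ψ e θ) :
    HasZ (fun t => φ t * ψ t) (d * ψ θ + φ θ * e) θ := by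
  unfold HasZ at *
  exact (HasDerivAt.fun_mul h k).congr_deriv (by ring)

theorem HasZ.const_mul {φ : ℝ → ℂ} {d : ℂ} {θ : ℝ} (c : ℂ) (h : HasZ φ d θ) :
    HasZ (fun t => c * φ t) (c * d) θ := by
  unfold HasZ at *
  exact (HasDerivAt.const_mul c h).congr_deriv (by ring)

theorem HasZ.pow {φ : ℝ → ℂ} {d : ℂ} {θ : ℝ} (h : HasZ φ d θ) (k : ℕ) :
    HasZ (fun t => φ t ^ k) (k * φ θ ^ (k - 1) * d) θ := by
  unfold HasZ at *
  exact (HasDerivAt.fun_pow h k).congr_deriv (by ring)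

theorem HasZ.zpow {φ : ℝ → ℂ} {d : ℂ} {θ : ℝ} (h : HasZ φ d θ) (h0 : φ θ ≠ 0) (k : ℤ) :
    HasZ (fun t => φ t ^ k) (k * φ θ ^ (k - 1) * d) θ := by
  unfold HasZ at *
  exact ((hasDerivAt_zpow k (φ θ) (Or.inl h0)).comp θ h).congr_deriv (by ring)

theorem HasZ.sum {ι : Type*} {s : Finset ι} {φ : ι → ℝ → ℂ} {d : ι → ℂ} {θ : ℝ}
    (h : ∀ i ∈ s, HasZ (φ i) (d i) θ) :
    HasZ (fun t => ∑ i ∈ s, φ i t) (∑ i ∈ s, d i) θ := by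
  unfold HasZ at *
  rw [Finset.sum_mul]
  exact HasDerivAt.fun_sum h

theorem HasZ.congr {φ ψ : ℝ → ℂ} {d : ℂ} {θ : ℝ} {V : Set ℝ} (hV : IsOpen V) (hθ : θ ∈ V)
    (h : HasZ φ d θ) (e : ∀ t ∈ V, ψ t = φ t) : HasZ ψ d θ :=
  HasDerivAt.congr_of_eventuallyEq h (Filter.eventuallyEq_of_mem (hV.mem_nhds hθ) e)

theorem contDiff_iexp : ContDiff ℝ ∞ fun θ : ℝ => Complex.I * Complex.exp (θ * Complex.I) := by
  have h : ContDiff ℝ ∞ fun θ : ℝ => (θ : ℂ) := Complex.ofRealCLM.contDiff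
  exact contDiff_const.mul (h.mul contDiff_const).cexp

theorem contDiffOn_zDeriv {φ : ℝ → ℂ} {V : Set ℝ} (hV : IsOpen V) (h : ContDiffOn ℝ ∞ φ V) :
    ContDiffOn ℝ ∞ (zDeriv φ) V := by
  have h1 : ContDiffOn ℝ ∞ (deriv φ) V := h.deriv_of_isOpen hV (by simp)
  have h2 : ContDiffOn ℝ ∞ (fun θ => deriv φ θ *
      (Complex.I * Complex.exp (θ * Complex.I))⁻¹) V :=
    h1.mul (contDiff_iexp.contDiffOn.inv fun θ _ => iexp_ne θ)
  simp only [← div_eq_mul_inv] at h2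
  exact h2

theorem contDiffOn_zDeriv_iter {φ : ℝ → ℂ} {V : Set ℝ} (hV : IsOpen V)
    (h : ContDiffOn ℝ ∞ φ V) (k : ℕ) : ContDiffOn ℝ ∞ (zDeriv^[k] φ) V := by
  induction k with
  | zero => simpa using h
  | succ k ih => rw [Function.iterate_succ_apply']; exact contDiffOn_zDeriv hV ih

theorem contDiff_zDeriv_iter {φ : ℝ → ℂ} (h : ContDiff ℝ ∞ φ) (k : ℕ) :
    ContDiff ℝ ∞ (zDeriv^[k] φ) :=
  contDiffOn_univ.1 (contDiffOn_zDeriv_iter isOpen_univ h.contDiffOn k)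

theorem ContDiff.hasZ {φ : ℝ → ℂ} (h : ContDiff ℝ ∞ φ) (θ : ℝ) : HasZ φ (zDeriv φ θ) θ :=
  hasZ_of_differentiableAt ((h.differentiable (by simp)) θ)

section Ring

variable {T : ℝ → ℂ}

theorem contDiff_schwarzian (hT : ContDiff ℝ ∞ T) (h0 : ∀ θ, zDeriv T θ ≠ 0) :
    ContDiff ℝ ∞ (schwarzian T) := by
  have h1 := contDiff_zDeriv_iter hT 1
  have h2 := contDiff_zDeriv_iter hT 2
  have h3 := contDiff_zDeriv_iter hT 3
  have h4 : ContDiff ℝ ∞ fun θ => (zDeriv T θ)⁻¹ := ContDiff.inv h1 h0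
  have h5 : ContDiff ℝ ∞ fun θ => zDeriv^[3] T θ * (zDeriv T θ)⁻¹ -
      3 / 2 * (zDeriv^[2] T θ * (zDeriv T θ)⁻¹) ^ 2 :=
    (h3.mul h4).sub (contDiff_const.mul ((h2.mul h4).pow 2))
  simp only [← div_eq_mul_inv] at h5
  exact h5

theorem schwarzianRing_aux (hT : ContDiff ℝ ∞ T) (h0 : ∀ θ, zDeriv T θ ≠ 0) {f : ℝ → ℂ}
    (hf : f ∈ schwarzianRing T) : ContDiff ℝ ∞ f ∧ zDeriv f ∈ schwarzianRing T := by
  unfold schwarzianRing at hf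
  induction hf using Algebra.adjoin_induction with
  | mem x hx =>
    obtain ⟨k, rfl⟩ := hx
    refine ⟨contDiff_zDeriv_iter (contDiff_schwarzian hT h0) k, ?_⟩
    refine Algebra.subset_adjoin ⟨k + 1, ?_⟩
    simp only [Function.iterate_succ_apply']
  | algebraMap r =>
    refine ⟨contDiff_const, ?_⟩
    have : zDeriv (algebraMap ℂ (ℝ → ℂ) r) = 0 := by
      funext θ
      have : (algebraMap ℂ (ℝ → ℂ) r) = fun _ => r := rfl
      simp [zDeriv, this]
    rw [this]
    exact zero_mem _
  | add x y hx hy ihx ihy =>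
    refine ⟨ihx.1.add ihy.1, ?_⟩
    have : zDeriv (x + y) = zDeriv x + zDeriv y := by
      funext θ
      exact ((ContDiff.hasZ ihx.1 θ).add (ContDiff.hasZ ihy.1 θ)).zDeriv_eq
    rw [this]
    exact add_mem ihx.2 ihy.2
  | mul x y hx hy ihx ihy =>
    refine ⟨ihx.1.mul ihy.1, ?_⟩
    have : zDeriv (x * y) = zDeriv x * y + x * zDeriv y := by
      funext θ
      exact ((ContDiff.hasZ ihx.1 θ).mul (ContDiff.hasZ ihy.1 θ)).zDeriv_eq
    rw [this]
    exact add_mem (mul_mem ihx.2 hy) (mul_mem hx ihy.2)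

/-- Coefficients of the iterates `L₀ = 1`, `L₁ = d/dz`,
`L_{k+2} = (d/dz) L_{k+1} + ((k+1)(N-k)/2) S L_k`: `L_k = ∑ m, opCoeff N S k m (d/dz)^{k-m}`. -/
def opCoeff (N : ℂ) (S : ℝ → ℂ) : ℕ → ℕ → ℝ → ℂ
  | 0, 0 => 1
  | 0, _ + 1 => 0
  | 1, 0 => 1
  | 1, _ + 1 => 0
  | k + 2, 0 => opCoeff N S (k + 1) 0
  | k + 2, 1 => opCoeff N S (k + 1) 1 + zDeriv (opCoeff N S (k + 1) 0)
  | k + 2, m + 2 => opCoeff N S (k + 1) (m + 2) + zDeriv (opCoeff N S (k + 1) (m + 1)) +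
      (((k : ℂ) + 1) * (N - k) / 2) • (S * opCoeff N S k m)

theorem zDeriv_zero : zDeriv 0 = 0 := by
  funext θ
  simp [zDeriv]

theorem zDeriv_one : zDeriv 1 = 0 := by
  funext θ
  have : (1 : ℝ → ℂ) = fun _ => 1 := rfl
  simp [zDeriv, this]

theorem opCoeff_zero (N : ℂ) (S : ℝ → ℂ) (k : ℕ) : opCoeff N S k 0 = 1 := by
  induction k using Nat.twoStepInduction with
  | zero => simp [opCoeff]
  | one => simp [opCoeff]
  | more k _ ih => rw [opCoeff, ih]

theorem opCoeff_one (N : ℂ) (S : ℝ → ℂ) (k : ℕ) : opCoeff N S k 1 = 0 := by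
  induction k using Nat.twoStepInduction with
  | zero => simp [opCoeff]
  | one => simp [opCoeff]
  | more k _ ih => rw [opCoeff, ih, opCoeff_zero, zDeriv_one, add_zero]

theorem opCoeff_big (N : ℂ) (S : ℝ → ℂ) (k : ℕ) : ∀ m, k < m → opCoeff N S k m = 0 := by
  induction k using Nat.twoStepInduction with
  | zero => intro m hm; obtain ⟨m, rfl⟩ := Nat.exists_eq_succ_of_ne_zero hm.ne'; simp [opCoeff]
  | one =>
    intro m hm
    obtain ⟨m, rfl⟩ := Nat.exists_eq_succ_of_ne_zero (Nat.ne_of_gt (by omega : 0 < m))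
    simp [opCoeff]
  | more k ih1 ih2 =>
    intro m hm
    obtain ⟨m, rfl⟩ := Nat.exists_eq_add_of_le' (by omega : 2 ≤ m)
    rw [opCoeff, ih1 m (by omega), ih2 (m + 1) (by omega), ih2 (m + 2) (by omega), zDeriv_zero]
    simp

theorem opCoeff_mem (hT : ContDiff ℝ ∞ T) (h0 : ∀ θ, zDeriv T θ ≠ 0) (N : ℂ) (k : ℕ) :
    ∀ m, opCoeff N (schwarzian T) k m ∈ schwarzianRing T := by
  induction k using Nat.twoStepInduction with
  | zero => rintro (_ | m) <;> simp only [opCoeff] <;> simp [one_mem, zero_mem]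
  | one => rintro (_ | m) <;> simp only [opCoeff] <;> simp [one_mem, zero_mem]
  | more k ih1 ih2 =>
    rintro (_ | _ | m)
    · rw [opCoeff]; exact ih2 0
    · rw [opCoeff]; exact add_mem (ih2 1) (schwarzianRing_aux hT h0 (ih2 0)).2
    · rw [opCoeff]
      refine add_mem (add_mem (ih2 _) (schwarzianRing_aux hT h0 (ih2 _)).2) ?_
      have hS : schwarzian T ∈ schwarzianRing T := Algebra.subset_adjoin ⟨0, rfl⟩
      exact Subalgebra.smul_mem _ (mul_mem hS (ih1 m)) _

end Ring

/-- The numbers `C(k,i) (N-i)(N-i-1)⋯(N-k+1)`. -/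
def opNum (N : ℂ) (k i : ℕ) : ℂ := k.choose i * ∏ r ∈ Finset.Ico i k, (N - r)

theorem opNum_big (N : ℂ) {k i : ℕ} (h : k < i) : opNum N k i = 0 := by
  simp [opNum, Nat.choose_eq_zero_of_lt h]

theorem opNum_self (N : ℂ) (k : ℕ) : opNum N k k = 1 := by simp [opNum]

theorem opNum_succ_zero (N : ℂ) (k : ℕ) : opNum N (k + 1) 0 = opNum N k 0 * (N - k) := by
  simp [opNum, Finset.prod_range_succ]

theorem opNum_succ_succ (N : ℂ) (k i : ℕ) :
    opNum N (k + 1) (i + 1) = opNum N k (i + 1) * (N - (i + 1) - k) + opNum N k i := by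
  rcases lt_trichotomy k i with h | rfl | h
  · rw [opNum_big N (by omega), opNum_big N (by omega), opNum_big N h]; simp
  · rw [opNum_self, opNum_self, opNum_big N (by omega)]; simp
  · have h1 := Finset.prod_Ico_succ_top (show i + 1 ≤ k by omega) (fun r : ℕ => N - (r : ℂ))
    have h2 := Finset.prod_eq_prod_Ico_succ_bot h (fun r : ℕ => N - (r : ℂ))
    have h3 : ((k.choose (i + 1) : ℕ) : ℂ) * ((i : ℂ) + 1) = (k.choose i : ℂ) * (k - i) := by
      have := Nat.choose_succ_right_eq k i
      have h4 : ((k - i : ℕ) : ℂ) = (k : ℂ) - i := by push_cast [h.le]; ring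
      rw [← h4]; exact_mod_cast this
    unfold opNum
    rw [h1, h2, Nat.choose_succ_succ]
    push_cast
    linear_combination (∏ r ∈ Finset.Ico (i + 1) k, (N - (r : ℂ))) * h3

theorem opNum_mul (N : ℂ) (k i : ℕ) (h : i ≤ k) :
    opNum N (k + 1) i * ((k : ℂ) + 1 - i) = (k + 1) * (N - k) * opNum N k i := by
  have h1 := Finset.prod_Ico_succ_top h (fun r : ℕ => N - (r : ℂ))
  have h3 : (((k + 1).choose i : ℕ) : ℂ) * ((k : ℂ) + 1 - i) = (k.choose i : ℂ) * (k + 1) := by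
    have := Nat.choose_mul_succ_eq k i
    have h4 : ((k + 1 - i : ℕ) : ℂ) = (k : ℂ) + 1 - i := by push_cast [Nat.le_succ_of_le h]; ring
    rw [← h4]; exact_mod_cast this.symm
  unfold opNum
  rw [h1]
  linear_combination (∏ r ∈ Finset.Ico i k, (N - (r : ℂ))) * (N - k) * h3

/-- The closed form of the iterates `L_k`. -/
def opVal (N : ℂ) (v : ℝ → ℂ) (E : ℕ → ℝ → ℂ) (k : ℕ) (t : ℝ) : ℂ :=
  ∑ i ∈ Finset.range (k + 1), opNum N k i * (v t ^ (k - i) * E i t)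

theorem opVal_succ (N : ℂ) (v : ℝ → ℂ) (E : ℕ → ℝ → ℂ) (k : ℕ) (t : ℝ) :
    opVal N v E (k + 1) t = ∑ i ∈ Finset.range (k + 1),
      (opNum N k i * (N - i - k) * (v t ^ (k + 1 - i) * E i t) +
        opNum N k i * (v t ^ (k - i) * E (i + 1) t)) := by
  unfold opVal
  have h1 : ∑ i ∈ Finset.range (k + 1),
      (opNum N k i * (N - i - k) * (v t ^ (k + 1 - i) * E i t)) =
      ∑ i ∈ Finset.range (k + 1),
        (opNum N k (i + 1) * (N - (i + 1) - k) * (v t ^ (k - i) * E (i + 1) t)) +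
      opNum N k 0 * (N - k) * (v t ^ (k + 1) * E 0 t) := by
    have := Finset.sum_range_succ
      (fun i : ℕ => opNum N k i * (N - i - k) * (v t ^ (k + 1 - i) * E i t)) (k + 1)
    rw [opNum_big N (Nat.lt_succ_self k)] at this
    simp only [zero_mul, add_zero] at this
    rw [← this, Finset.sum_range_succ']
    simp
  rw [Finset.sum_add_distrib, h1, Finset.sum_range_succ', opNum_succ_zero]
  simp only [opNum_succ_succ, Nat.add_sub_add_right, Nat.sub_zero]
  rw [add_right_comm, ← Finset.sum_add_distrib]
  congr 1
  refine Finset.sum_congr rfl fun i _ => ?_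
  ring

theorem opVal_hasZ {N : ℂ} {v S : ℝ → ℂ} {E : ℕ → ℝ → ℂ} {t : ℝ}
    (hv : HasZ v (-(S t) / 2 - v t ^ 2) t)
    (hE : ∀ i, HasZ (E i) ((N - 2 * i) * v t * E i t + E (i + 1) t) t) (k : ℕ) :
    HasZ (opVal N v E k)
      (opVal N v E (k + 1) t - k * (N - (k - 1)) / 2 * S t * opVal N v E (k - 1) t) t := by
  have h := HasZ.sum (s := Finset.range (k + 1))
    (fun i _ => (((hv.pow (k - i)).mul (hE i)).const_mul (opNum N k i)))
  refine HasDerivAt.congr_deriv h ?_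
  congr 1
  have h2 : (k * (N - (k - 1)) / 2 * S t * opVal N v E (k - 1) t : ℂ) =
      ∑ i ∈ Finset.range (k + 1),
        opNum N k i * ((k : ℂ) - i) * (S t / 2) * (v t ^ (k - i - 1) * E i t) := by
    rcases k with _ | k
    · simp
    · rw [Finset.sum_range_succ]
      simp only [sub_self, mul_zero, zero_mul, add_zero, Nat.add_sub_cancel]
      unfold opVal
      rw [Finset.mul_sum]
      refine Finset.sum_congr rfl fun i hi => ?_
      have hi' : i ≤ k := by simpa [Nat.lt_succ_iff] using hi
      have := opNum_mul N k i hi'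
      have e : k + 1 - i - 1 = k - i := by omega
      rw [e]
      push_cast
      linear_combination (-(S t) / 2 * (v t ^ (k - i) * E i t)) * this
  rw [h2, opVal_succ, ← Finset.sum_sub_distrib]
  refine Finset.sum_congr rfl fun i hi => ?_
  have hi' : i ≤ k := by simpa [Nat.lt_succ_iff] using hi
  obtain ⟨j, rfl⟩ := Nat.exists_eq_add_of_le hi'
  have e1 : i + j + 1 - i = j + 1 := by omega
  have e2 : i + j - i = j := by omega
  rw [e1, e2]
  rcases j with _ | j
  · simp; ring
  · simp only [Nat.add_sub_cancel]
    push_cast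
    ring

theorem opCoeff_sum {N : ℂ} {T v : ℝ → ℂ} {E : ℕ → ℝ → ℂ} {V : Set ℝ} (hV : IsOpen V)
    (hT : ContDiff ℝ ∞ T) (h0 : ∀ θ, zDeriv T θ ≠ 0)
    (hv : ∀ t ∈ V, HasZ v (-(schwarzian T t) / 2 - v t ^ 2) t)
    (hE : ∀ t ∈ V, ∀ i, HasZ (E i) ((N - 2 * i) * v t * E i t + E (i + 1) t) t)
    (hs : ContDiffOn ℝ ∞ (E 0) V) (k : ℕ) :
    ∀ t ∈ V, opVal N v E k t = ∑ m ∈ Finset.range (k + 1),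
      opCoeff N (schwarzian T) k m t * zDeriv^[k - m] (E 0) t := by
  have hD : ∀ j, ∀ t ∈ V, HasZ (zDeriv^[j] (E 0)) (zDeriv^[j + 1] (E 0) t) t := by
    intro j t ht
    rw [Function.iterate_succ_apply']
    exact hasZ_of_differentiableAt
      (((contDiffOn_zDeriv_iter hV hs j).contDiffAt (hV.mem_nhds ht)).differentiableAt (by simp))
  have ha : ∀ k m t, HasZ (opCoeff N (schwarzian T) k m)
      (zDeriv (opCoeff N (schwarzian T) k m) t) t := fun k m t =>
    ContDiff.hasZ (schwarzianRing_aux hT h0 (opCoeff_mem hT h0 N k m)).1 t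
  induction k using Nat.twoStepInduction with
  | zero => intro t _; simp [opVal, opNum_self, opCoeff]
  | one =>
    intro t ht
    have h1 := (opVal_hasZ (hv t ht) (hE t ht) 0).zDeriv_eq
    have h2 : opVal N v E 0 = E 0 := by funext s; simp [opVal, opNum_self]
    rw [h2] at h1
    simp at h1
    simp [opCoeff, Finset.sum_range_succ, h1]
  | more k ih1 ih2 =>
    intro t ht
    have h1 := (opVal_hasZ (hv t ht) (hE t ht) (k + 1)).zDeriv_eq
    have h2 := (HasZ.congr hV ht (HasZ.sum (s := Finset.range (k + 1 + 1))
      fun m _ => (ha (k + 1) m t).mul (hD (k + 1 - m) t ht)) ih2).zDeriv_eq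
    rw [h1] at h2
    simp only [Nat.add_sub_cancel] at h2
    rw [ih1 t ht] at h2
    rw [sub_eq_iff_eq_add] at h2
    rw [h2, Finset.mul_sum, Finset.sum_add_distrib]
    have s1 : ∑ m ∈ Finset.range (k + 2 + 1),
        opCoeff N (schwarzian T) (k + 2) m t * zDeriv^[k + 2 - m] (E 0) t =
        ∑ m ∈ Finset.range (k + 1),
          opCoeff N (schwarzian T) (k + 2) (m + 2) t * zDeriv^[k - m] (E 0) t +
        opCoeff N (schwarzian T) (k + 2) 1 t * zDeriv^[k + 1] (E 0) t +
        opCoeff N (schwarzian T) (k + 2) 0 t * zDeriv^[k + 2] (E 0) t := by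
      rw [Finset.sum_range_succ', Finset.sum_range_succ']
      simp
    have s2 : ∑ m ∈ Finset.range (k + 1 + 1),
        opCoeff N (schwarzian T) (k + 1) m t * zDeriv^[k + 1 - m + 1] (E 0) t =
        ∑ m ∈ Finset.range (k + 1),
          opCoeff N (schwarzian T) (k + 1) (m + 2) t * zDeriv^[k - m] (E 0) t +
        opCoeff N (schwarzian T) (k + 1) 1 t * zDeriv^[k + 1] (E 0) t +
        opCoeff N (schwarzian T) (k + 1) 0 t * zDeriv^[k + 2] (E 0) t := by
      have b := opCoeff_big N (schwarzian T) (k + 1) (k + 2) (by omega)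
      rw [Finset.sum_range_succ', Finset.sum_range_succ', Finset.sum_range_succ (n := k), b]
      simp only [Pi.zero_apply, zero_mul, add_zero, Nat.sub_zero]
      congr 1
      congr 1
      refine Finset.sum_congr rfl fun m hm => ?_
      have : m < k := by simpa using hm
      rw [show k + 1 - (m + 1 + 1) + 1 = k - m by omega]
    have s3 : ∑ m ∈ Finset.range (k + 1 + 1),
        zDeriv (opCoeff N (schwarzian T) (k + 1) m) t * zDeriv^[k + 1 - m] (E 0) t =
        ∑ m ∈ Finset.range (k + 1),
          zDeriv (opCoeff N (schwarzian T) (k + 1) (m + 1)) t * zDeriv^[k - m] (E 0) t +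
        zDeriv (opCoeff N (schwarzian T) (k + 1) 0) t * zDeriv^[k + 1] (E 0) t := by
      rw [Finset.sum_range_succ']
      simp
    rw [s1, s2, s3]
    simp only [opCoeff, Pi.add_apply, Pi.smul_apply, Pi.mul_apply, smul_eq_mul, add_mul,
      Finset.sum_add_distrib]
    have s4 : ∀ m, ((k + 1 : ℕ) : ℂ) * (N - (((k + 1 : ℕ) : ℂ) - 1)) / 2 * schwarzian T t *
        (opCoeff N (schwarzian T) k m t * zDeriv^[k - m] (E 0) t) =
        ((k : ℂ) + 1) * (N - k) / 2 * (schwarzian T t * opCoeff N (schwarzian T) k m t) *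
          zDeriv^[k - m] (E 0) t := by
      intro m; push_cast; ring
    simp only [s4]
    ring_nf

theorem exists_isSchwarzianCoeffs {n : ℕ} (hn : 1 ≤ n) {T : ℝ → ℂ} (hT : ContDiff ℝ ∞ T)
    (h0 : ∀ θ, zDeriv T θ ≠ 0) : ∃ ξ, IsSchwarzianCoeffs n T ξ := by
  classical
  set N : ℂ := 2 * n - 2 with hN
  refine ⟨fun m => if m ∈ Finset.Icc 2 (2 * n - 1) then
    opCoeff N (schwarzian T) (2 * n - 1) m else 0, ?_, ?_, ?_⟩
  · intro m
    by_cases hm : m ∈ Finset.Icc 2 (2 * n - 1)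
    · simp only [hm, if_true]; exact opCoeff_mem hT h0 N _ m
    · simp only [hm, if_false]; exact zero_mem _
  · intro m hm
    simp only [hm, if_false]
  intro h θ hθ
  obtain ⟨U, hU, hUo, hTU⟩ := eventually_nhds_iff.1 hθ.eventually_analyticAt
  have hVo : IsOpen (T ⁻¹' U) := hUo.preimage hT.continuous
  set p := zDeriv T with hp
  have hpc : ContDiff ℝ ∞ p := contDiff_zDeriv_iter hT 1
  have hp1 : ∀ t, HasZ p (zDeriv^[2] T t) t := fun t => ContDiff.hasZ hpc t
  have hp2 : ∀ t, HasZ (zDeriv^[2] T) (zDeriv^[3] T t) t := fun t =>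
    ContDiff.hasZ (contDiff_zDeriv_iter hT 2) t
  set v : ℝ → ℂ := fun t => (-1 / 2) * (zDeriv^[2] T t * p t ^ (-1 : ℤ)) with hvdef
  have hv : ∀ t, HasZ v (-(schwarzian T t) / 2 - v t ^ 2) t := by
    intro t
    convert ((hp2 t).mul ((hp1 t).zpow (h0 t) (-1))).const_mul (-1 / 2 : ℂ) using 1
    have h0t : p t ≠ 0 := h0 t
    have e : p t ^ ((-1 : ℤ) - 1) = (p t ^ 2)⁻¹ := by
      rw [show ((-1 : ℤ) - 1) = -((2 : ℕ) : ℤ) by norm_num, zpow_neg, zpow_natCast]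
    rw [e]
    simp only [hvdef, schwarzian, ← hp, zpow_neg_one]
    push_cast
    field_simp
    ring
  set E : ℕ → ℝ → ℂ := fun i t => p t ^ (1 - (n : ℤ) + i) * iteratedDeriv i h (T t) with hEdef
  have hE : ∀ t ∈ T ⁻¹' U, ∀ i, HasZ (E i) ((N - 2 * i) * v t * E i t + E (i + 1) t) t := by
    intro t ht i
    have a : AnalyticAt ℂ h (T t) := hU _ ht
    have a2 : DifferentiableAt ℂ (iteratedDeriv i h) (T t) := by
      rw [iteratedDeriv_eq_iterate]
      exact (a.iterated_deriv i).differentiableAt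
    have a3 : HasZ (fun s => iteratedDeriv i h (T s)) (p t * iteratedDeriv (i + 1) h (T t)) t := by
      have b := a2.hasDerivAt.comp t (ContDiff.hasZ hT t)
      refine b.congr_deriv ?_
      rw [iteratedDeriv_succ]
      ring
    convert ((hp1 t).zpow (h0 t) (1 - (n : ℤ) + i)).mul a3 using 1
    have h0t : p t ≠ 0 := h0 t
    simp only [hEdef, hvdef]
    have e1 : p t ^ (1 - (n : ℤ) + ((i + 1 : ℕ) : ℤ)) = p t ^ (1 - (n : ℤ) + i) * p t := by
      rw [← zpow_add_one₀ h0t]; congr 1; push_cast; ring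
    have e2 : p t ^ (1 - (n : ℤ) + i - 1) = p t ^ (1 - (n : ℤ) + i) * (p t)⁻¹ :=
      zpow_sub_one₀ h0t _
    rw [e1, e2, zpow_neg_one]
    push_cast
    rw [hN]
    ring
  have hE0 : E 0 = pullback n T h := by
    funext t
    simp only [hEdef, pullback, iteratedDeriv_zero, Nat.cast_zero, add_zero, ← hp]
    ring
  have hs : ContDiffOn ℝ ∞ (E 0) (T ⁻¹' U) := by
    intro t ht
    apply ContDiffAt.contDiffWithinAt
    rw [hE0]
    have c1 : ContDiffAt ℝ ∞ (fun s => h (T s)) t := by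
      have a : AnalyticAt ℂ h (T t) := hU _ ht
      exact ((a.contDiffAt (n := ∞)).restrict_scalars ℝ).comp t hT.contDiffAt
    have c2 : ContDiffAt ℝ ∞ (fun s => p s ^ (1 - (n : ℤ))) t := by
      have a : AnalyticAt ℂ (fun w : ℂ => w ^ (1 - (n : ℤ))) (p t) :=
        analyticAt_id.zpow (h0 t)
      exact ((a.contDiffAt (n := ∞)).restrict_scalars ℝ).comp t hpc.contDiffAt
    exact c1.mul c2
  have key := opCoeff_sum (N := N) hVo hT h0 (fun t _ => hv t) hE hs (2 * n - 1) θ hTU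
  have hl : opVal N v E (2 * n - 1) θ = iteratedDeriv (2 * n - 1) h (T θ) * p θ ^ n := by
    unfold opVal
    rw [Finset.sum_range_succ, opNum_self, Finset.sum_eq_zero]
    · simp only [hEdef, Nat.sub_self, pow_zero, one_mul, zero_add]
      rw [show (1 - (n : ℤ) + ((2 * n - 1 : ℕ) : ℤ)) = (n : ℤ) by omega, zpow_natCast]
      ring
    · intro i hi
      have hi' : i < 2 * n - 1 := by simpa using hi
      have : ∏ r ∈ Finset.Ico i (2 * n - 1), (N - (r : ℂ)) = 0 := by
        refine Finset.prod_eq_zero (i := 2 * n - 2) (by simp; omega) ?_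
        rw [hN, Nat.cast_sub (by omega)]
        push_cast
        ring
      simp [opNum, this]
  rw [hl, hE0] at key
  rw [key]
  have r : Finset.range (2 * n - 1 + 1) = insert 0 (insert 1 (Finset.Icc 2 (2 * n - 1))) := by
    ext m
    simp only [Finset.mem_range, Finset.mem_insert, Finset.mem_Icc]
    omega
  rw [r, Finset.sum_insert (by simp), Finset.sum_insert (by simp), opCoeff_zero, opCoeff_one]
  simp only [Pi.one_apply, Pi.zero_apply, one_mul, zero_mul, zero_add, Nat.sub_zero]
  rw [eq_sub_iff_add_eq]
  congr 1
  refine Finset.sum_congr rfl fun m hm => ?_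
  rw [if_pos hm]

theorem DiffPlus.contDiff_fn (γ : DiffPlus) : ContDiff ℝ ∞ γ.fn := by
  have : Fact (Module.finrank ℝ ℂ = 1 + 1) := finrank_real_complex_fact'
  have h1 : ContMDiff (𝓡 1) 𝓘(ℝ, ℂ) ∞ (fun z : Circle => (z : ℂ)) := contMDiff_coe_sphere
  exact (h1.comp (γ.toDiffeo.contMDiff.comp contMDiff_circleExp)).contDiff

theorem DiffPlus.zDeriv_fn_ne (γ : DiffPlus) (θ : ℝ) : zDeriv γ.fn θ ≠ 0 := by
  intro h
  have := γ.orientation θ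
  change 0 < (Complex.exp (θ * Complex.I) * zDeriv γ.fn θ / _).re at this
  simp [h] at this

/-! ### The matrix `𝔖₁[γ; n]` -/

/-- The coefficients `ξ[γ; n]_m`: the functions singled out by `IsSchwarzianCoeffs` (they are unique,
because the jet of `h ∘ γ (γ')^{1-n}` at a given point can be prescribed arbitrarily). -/
def xi (γ : DiffPlus) (n : ℕ) (hn : 1 ≤ n) : ℕ → ℝ → ℂ :=
  (exists_isSchwarzianCoeffs hn γ.contDiff_fn γ.zDeriv_fn_ne).choose

theorem xi_spec (γ : DiffPlus) (n : ℕ) (hn : 1 ≤ n) : IsSchwarzianCoeffs n γ.fn (xi γ n hn) :=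
  (exists_isSchwarzianCoeffs hn γ.contDiff_fn γ.zDeriv_fn_ne).choose_spec

/-- `α_n = 2^{2n-2} / ((2n-2)! π)`. -/
def alpha (n : ℕ) : ℝ := 2 ^ (2 * n - 2) / ((2 * n - 2).factorial * Real.pi)

/-- `c[n]_k`, which is `√α_n √((|k|+n-1)! / (|k|-n)!)` if `|k| ≥ n` and `√α_n` if `|k| < n`. -/
def c (n : ℕ) (k : ℤ) : ℝ :=
  if n ≤ k.natAbs then
    √(alpha n) * √(((k.natAbs + n - 1).factorial : ℝ) / (k.natAbs - n).factorial)
  else √(alpha n)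

/-- `c[1-n]_k = α_n / c[n]_k`. -/
def cDual (n : ℕ) (k : ℤ) : ℝ := alpha n / c n k

/-- `sgn_n k`. -/
def sgn (n : ℕ) (k : ℤ) : ℂ := if (n : ℤ) ≤ k then 1 else -1

/-- The coefficients `Ξ[γ; n; m]_k` of the Fourier expansion
`ξ[γ; n]_m (e^{iθ}) = ∑_k Ξ[γ; n; m]_k c[2]_k e^{i(k-m)θ}`. -/
def Xi (γ : DiffPlus) (n : ℕ) (hn : 1 ≤ n) (m : ℕ) (k : ℤ) : ℂ :=
  (1 / (2 * Real.pi) * ∫ θ in (0 : ℝ)..2 * Real.pi,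
    xi γ n hn m θ * Complex.exp (-Complex.I * ((k - m : ℤ) : ℂ) * θ)) / c 2 k

/-- The `ℤ × ℤ` matrix
`𝔖[γ; n]_{lj} = sgn_n(j) ∑_{m=2}^{2n-1} Ξ[γ;n;m]_{l-j} (c[2]_{l-j} c[1-n]_j / c[n]_l)
(j+n-1)(j+n-2)⋯(j-n+m+1)`;
the last product has the `2n-1-m` factors `j+n-1-r`, `0 ≤ r < 2n-1-m`. -/
def frakS (γ : DiffPlus) (n : ℕ) (hn : 1 ≤ n) : Matrix ℤ ℤ ℂ := fun l j =>
  sgn n j * ∑ m ∈ Finset.Icc 2 (2 * n - 1),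
    Xi γ n hn m (l - j) * ((c 2 (l - j) : ℂ) * cDual n j / c n l) *
      ∏ r ∈ Finset.range (2 * n - 1 - m), ((j : ℂ) + n - 1 - r)

/-- `𝔖₁[γ; n] = (𝔖[γ; n]_{lk})_{l,k ≥ n}`. -/
def frakS₁ (γ : DiffPlus) (n : ℕ) (hn : 1 ≤ n) :
    Matrix {k : ℤ // (n : ℤ) ≤ k} {k : ℤ // (n : ℤ) ≤ k} ℂ :=
  (frakS γ n hn).submatrix (fun l => (l : ℤ)) (fun k => (k : ℤ))

/-! ### Trace class operators -/

/-- A bounded operator `T` on a complex Hilbert space is of trace class if the trace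
`∑ ⟨e_i, |T| e_i⟩` of `|T| = √(T* T)` in an orthonormal basis is finite. (The sum of non-negative
terms does not depend on the basis.) -/
def IsTraceClass.{u} {H : Type u} [NormedAddCommGroup H] [InnerProductSpace ℂ H] [CompleteSpace H]
    (T : H →L[ℂ] H) : Prop :=
  ∃ (ι : Type u) (b : HilbertBasis ι ℂ H), Summable fun i => (inner ℂ (b i) (CFC.abs T (b i))).re

/-- The matrix `M` defines a trace class operator on `ℓ²`: there is a trace class operator `T` with
`(T v)_l = ∑_k M_{lk} v_k`, the series being convergent. -/
def DefinesTraceClass {ι : Type*} (M : Matrix ι ι ℂ) : Prop :=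
  ∃ T : lp (fun _ : ι => ℂ) 2 →L[ℂ] lp (fun _ : ι => ℂ) 2,
    (∀ v l, HasSum (fun k => M l k * v k) (T v l)) ∧ IsTraceClass T

end CircleSchwarzian

end

namespace CircleSchwarzian

/-! The entries of `frakS₁` are absolutely summable, and such a matrix is an absolutely convergent
sum of rank-one operators, hence trace class (`definesTraceClass_of_summable`).

All that is needed of `ξ_m` is that it is smooth and periodic, which follows from its being a
polynomial in the Schwarzian and its derivatives. Its Fourier coefficients, which are `Ξ · c[2]`,
therefore decay faster than any power of `l - j`. For `l = n + a`, `j = n + b` the remaining weight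
`c[1-n]_j / c[n]_l` is at most `((a+1)(b+1))^{-(2n-1)/2}`, while the product over `r` is
`O((b+1)^{2n-3})`, since `m ≥ 2`. Near the diagonal `a` and `b` are comparable, so together these
give `(b+1)^{-2}`; away from it, the loss is a power of `1 + |l - j|`, which the Fourier decay
absorbs (`pow_div_sqrt_pow_le`). Hence the entry is `O((1+|l-j|)^{-2} (1+|j-n|)^{-2})`, which is
summable over all pairs. For `n = 1` there is no index `m` and the matrix vanishes. -/

/-! ### Trace class criteria -/

/-- Both squared norms equal `⟨T* T v, v⟩`, because `|T|² = T* T` and `|T|` is self-adjoint. -/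
theorem norm_cfcAbs_apply {H : Type*} [NormedAddCommGroup H] [InnerProductSpace ℂ H]
    [CompleteSpace H] (T : H →L[ℂ] H) (v : H) : ‖CFC.abs T v‖ = ‖T v‖ := by
  have hs : IsSelfAdjoint (CFC.abs T) := (CFC.abs_nonneg T).isSelfAdjoint
  have hm : CFC.abs T * CFC.abs T = star T * T := CFC.abs_mul_abs T
  have h1 : inner ℂ (CFC.abs T v) (CFC.abs T v) = inner ℂ (T v) (T v) := by
    have e1 := ContinuousLinearMap.adjoint_inner_left (CFC.abs T) v (CFC.abs T v)
    have e2 := ContinuousLinearMap.adjoint_inner_left T v (T v)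
    rw [← ContinuousLinearMap.star_eq_adjoint, hs.star_eq] at e1
    rw [← ContinuousLinearMap.star_eq_adjoint] at e2
    rw [← e1, ← e2]
    exact congrArg (fun A : H →L[ℂ] H => inner ℂ (A v) v) hm
  rw [inner_self_eq_norm_sq_to_K, inner_self_eq_norm_sq_to_K] at h1
  have h2 : ‖CFC.abs T v‖ ^ 2 = ‖T v‖ ^ 2 := by exact_mod_cast h1
  exact (sq_eq_sq₀ (norm_nonneg _) (norm_nonneg _)).1 h2

/-- Cauchy–Schwarz bounds each diagonal entry of `|T|` by `‖|T| b_i‖ = ‖T b_i‖`. -/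
theorem isTraceClass_of_summable_norm.{u} {ι H : Type u} [NormedAddCommGroup H]
    [InnerProductSpace ℂ H] [CompleteSpace H] (b : HilbertBasis ι ℂ H) (T : H →L[ℂ] H)
    (h : Summable fun i => ‖T (b i)‖) : IsTraceClass T := by
  refine ⟨ι, b, .of_norm_bounded h fun i => ?_⟩
  rw [← norm_cfcAbs_apply, Real.norm_eq_abs]
  calc |(inner ℂ (b i) (CFC.abs T (b i))).re| ≤ ‖inner ℂ (b i) (CFC.abs T (b i))‖ :=
        Complex.abs_re_le_norm _
    _ ≤ ‖b i‖ * ‖CFC.abs T (b i)‖ := norm_inner_le_norm _ _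
    _ = ‖CFC.abs T (b i)‖ := by rw [b.orthonormal.1 i, one_mul]

/-- A matrix with absolutely summable entries defines a trace class operator. -/
theorem definesTraceClass_of_summable {ι : Type*} {M : Matrix ι ι ℂ}
    (h : Summable fun p : ι × ι => ‖M p.1 p.2‖) : DefinesTraceClass M := by
  classical
  let e : ι → lp (fun _ : ι => ℂ) 2 := fun i => lp.single 2 i 1
  have he : ∀ i, ‖e i‖ = 1 := fun i => by simp [e, lp.norm_single]
  have hin : ∀ i (v : lp (fun _ : ι => ℂ) 2), inner ℂ (e i) v = v i := fun i v => by
    simp [e, lp.inner_single_left]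
  -- The operator is assembled from the rank-one pieces `v ↦ M_{lk} v_k e_l`, each of norm
  -- `|M_{lk}|`, so the series converges in operator norm.
  let R : ι × ι → lp (fun _ : ι => ℂ) 2 →L[ℂ] lp (fun _ : ι => ℂ) 2 :=
    fun p => M p.1 p.2 • (innerSL ℂ (e p.2)).smulRight (e p.1)
  have hR : Summable R := by
    refine .of_norm_bounded h fun p => ?_
    simp [R, norm_smul, ContinuousLinearMap.norm_smulRight_apply, he]
  have hRv : ∀ v, HasSum (fun p : ι × ι => (M p.1 p.2 * v p.2) • e p.1) ((∑' p, R p) v) := by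
    intro v
    have := (ContinuousLinearMap.apply ℂ _ v).hasSum hR.hasSum
    simpa [R, Function.comp_def, hin, smul_smul] using this
  refine ⟨∑' p, R p, fun v l => ?_, ?_⟩
  · have h1 := (innerSL ℂ (e l)).hasSum (hRv v)
    rw [innerSL_apply_apply, hin] at h1
    -- Only the pairs with first index `l` contribute to the `l`-th coordinate, so the double series
    -- reduces to the row sum.
    have hinj : Function.Injective fun k : ι => (l, k) := fun a b hab => (Prod.ext_iff.1 hab).2
    rw [← hinj.hasSum_iff] at h1
    · simpa [Function.comp_def, hin, e] using h1
    · rintro ⟨a, k⟩ hx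
      have : l ≠ a := by rintro rfl; exact hx ⟨k, rfl⟩
      simp [hin, e, this]
  · let b : HilbertBasis ι ℂ (lp (fun _ : ι => ℂ) 2) := ⟨LinearIsometryEquiv.refl ℂ _⟩
    have hb : ∀ i, b i = e i := fun i => by
      rw [← b.repr_symm_single i]; rfl
    refine isTraceClass_of_summable_norm b _ ?_
    -- `‖T e_j‖` is at most the `ℓ¹` norm of column `j`, and these norms are summable over `j`.
    have hcol := h.prod_symm.prod
    refine .of_nonneg_of_le (fun _ => norm_nonneg _) (fun j => ?_) hcol
    have h1 := hRv (b j)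
    have hinj : Function.Injective fun k : ι => (k, j) := fun a b hab => (Prod.ext_iff.1 hab).1
    rw [← hinj.hasSum_iff] at h1
    · rw [← h1.tsum_eq]
      refine tsum_of_norm_bounded (h.prod_symm.prod_factor j).hasSum fun i => ?_
      simp [hb, norm_smul, he, e]
    · rintro ⟨a, k⟩ hx
      have : k ≠ j := by rintro rfl; exact hx ⟨a, rfl⟩
      simp [hb, e, this]

/-! ### Periodicity -/

theorem zDeriv_periodic {φ : ℝ → ℂ} (h : Function.Periodic φ (2 * Real.pi)) :
    Function.Periodic (zDeriv φ) (2 * Real.pi) := by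
  intro θ
  have h1 : deriv φ (θ + 2 * Real.pi) = deriv φ θ := by
    rw [← deriv_comp_add_const]
    congr 1
    exact funext h
  have h2 : Complex.exp (((θ + 2 * Real.pi : ℝ) : ℂ) * Complex.I) =
      Complex.exp (θ * Complex.I) := by
    push_cast
    rw [add_mul, Complex.exp_periodic]
  simp only [zDeriv, h1, h2]

theorem zDeriv_iter_periodic {φ : ℝ → ℂ} (h : Function.Periodic φ (2 * Real.pi)) (k : ℕ) :
    Function.Periodic (zDeriv^[k] φ) (2 * Real.pi) := by
  induction k with
  | zero => exact h
  | succ k ih => rw [Function.iterate_succ_apply']; exact zDeriv_periodic ih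

theorem schwarzianRing_periodic {T : ℝ → ℂ} (hT : Function.Periodic T (2 * Real.pi))
    {f : ℝ → ℂ} (hf : f ∈ schwarzianRing T) : Function.Periodic f (2 * Real.pi) := by
  have hS : Function.Periodic (schwarzian T) (2 * Real.pi) := by
    intro θ
    have h1 := zDeriv_periodic hT θ
    have h2 := zDeriv_iter_periodic hT 2 θ
    have h3 := zDeriv_iter_periodic hT 3 θ
    simp only [schwarzian, h1, h2, h3]
  unfold schwarzianRing at hf
  induction hf using Algebra.adjoin_induction with
  | mem x hx => obtain ⟨k, rfl⟩ := hx; exact zDeriv_iter_periodic hS k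
  | algebraMap r => exact fun _ => rfl
  | add x y _ _ hx hy => exact hx.add hy
  | mul x y _ _ hx hy => exact hx.mul hy

theorem DiffPlus.periodic_fn (γ : DiffPlus) : Function.Periodic γ.fn (2 * Real.pi) := by
  intro θ
  simp [DiffPlus.fn, Circle.periodic_exp θ]

/-! ### Decay of Fourier coefficients -/

/-- Integration by parts; the boundary terms cancel by periodicity. -/
theorem integral_deriv_mul_exp {f : ℝ → ℂ} (hf : ContDiff ℝ ∞ f)
    (hp : Function.Periodic f (2 * Real.pi)) (k : ℤ) :
    ∫ θ in (0 : ℝ)..2 * Real.pi, deriv f θ * Complex.exp (-Complex.I * k * θ) =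
      Complex.I * k * ∫ θ in (0 : ℝ)..2 * Real.pi, f θ * Complex.exp (-Complex.I * k * θ) := by
  have hd : ∀ θ : ℝ, HasDerivAt (fun t : ℝ => Complex.exp (-Complex.I * k * t))
      (Complex.exp (-Complex.I * k * θ) * (-Complex.I * k)) θ := fun θ => by
    simpa using ((Complex.ofRealCLM.hasDerivAt (x := θ)).const_mul (-Complex.I * k)).cexp
  have hc : Continuous fun t : ℝ => Complex.exp (-Complex.I * k * t) := by fun_prop
  have h0 : f (2 * Real.pi) = f 0 := by simpa using hp 0
  have h1 : Complex.exp (-Complex.I * k * ((2 * Real.pi : ℝ) : ℂ)) = 1 := by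
    rw [Complex.exp_eq_one_iff]
    exact ⟨-k, by push_cast; ring⟩
  have := intervalIntegral.integral_deriv_mul_eq_sub (a := 0) (b := 2 * Real.pi)
    (fun θ _ => (hf.differentiable (by simp) θ).hasDerivAt) (fun θ _ => hd θ)
    ((hf.continuous_deriv (by simp)).intervalIntegrable _ _)
    ((hc.mul continuous_const).intervalIntegrable _ _)
  have hadd := intervalIntegral.integral_add (a := 0) (b := 2 * Real.pi) (μ := MeasureTheory.volume)
    (((hf.continuous_deriv (by simp)).mul hc).intervalIntegrable _ _)
    ((hf.continuous.mul (hc.mul (continuous_const (y := -Complex.I * (k : ℂ))))).intervalIntegrable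
      _ _)
  simp only [Pi.mul_apply] at hadd
  rw [h0, h1, hadd] at this
  simp only [Complex.ofReal_zero, mul_zero, Complex.exp_zero, sub_self, ← mul_assoc] at this
  rw [intervalIntegral.integral_mul_const, intervalIntegral.integral_mul_const] at this
  linear_combination this

/-- The Fourier coefficients of a smooth periodic function decay faster than any power. -/
theorem exists_norm_integral_mul_exp_le (p : ℕ) : ∀ {f : ℝ → ℂ}, ContDiff ℝ ∞ f →
    Function.Periodic f (2 * Real.pi) → ∃ C : ℝ, ∀ k : ℤ,
    |(k : ℝ)| ^ p * ‖∫ θ in (0 : ℝ)..2 * Real.pi, f θ * Complex.exp (-Complex.I * k * θ)‖ ≤ C := by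
  induction p with
  | zero =>
    intro f hf hp
    refine ⟨∫ θ in (0 : ℝ)..2 * Real.pi, ‖f θ‖, fun k => ?_⟩
    rw [pow_zero, one_mul]
    refine (intervalIntegral.norm_integral_le_integral_norm Real.two_pi_pos.le).trans_eq ?_
    congr 1
    ext θ
    rw [norm_mul, show -Complex.I * k * θ = ((-(k * θ) : ℝ) : ℂ) * Complex.I by push_cast; ring,
      Complex.norm_exp_ofReal_mul_I, mul_one]
  | succ p ih =>
    intro f hf hp
    have hd : ContDiff ℝ ∞ (deriv f) := by
      simpa using (contDiff_infty_iff_deriv.1 hf).2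
    obtain ⟨C, hC⟩ := ih hd fun θ => by
      rw [← deriv_comp_add_const]
      congr 1
      exact funext hp
    -- The bound of order `p` for `f'` is the bound of order `p + 1` for `f`, since differentiation
    -- multiplies the coefficient by `ik`.
    refine ⟨C, fun k => (le_of_eq ?_).trans (hC k)⟩
    rw [integral_deriv_mul_exp hf hp, norm_mul, norm_mul, Complex.norm_I, one_mul,
      Complex.norm_intCast, pow_succ, mul_assoc]

/-- The shift by `m` is absorbed by replacing `f` with `f e^{imθ}`, again smooth and periodic. The
weight `1 + |k|` is never zero, so the bound can be divided by it. -/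
theorem exists_norm_integral_mul_exp_shift_le {f : ℝ → ℂ} (hf : ContDiff ℝ ∞ f)
    (hp : Function.Periodic f (2 * Real.pi)) (m p : ℕ) : ∃ C : ℝ, ∀ k : ℤ,
    (1 + |(k : ℝ)|) ^ p * ‖∫ θ in (0 : ℝ)..2 * Real.pi,
      f θ * Complex.exp (-Complex.I * ((k - m : ℤ) : ℂ) * θ)‖ ≤ C := by
  have hg : ContDiff ℝ ∞ fun θ : ℝ => f θ * Complex.exp (m * (θ * Complex.I)) := by
    have h : ContDiff ℝ ∞ fun θ : ℝ => (θ : ℂ) := Complex.ofRealCLM.contDiff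
    exact hf.mul (contDiff_const.mul (h.mul contDiff_const)).cexp
  have hgp : Function.Periodic (fun θ : ℝ => f θ * Complex.exp (m * (θ * Complex.I)))
      (2 * Real.pi) := by
    intro θ
    have : Complex.exp (m * (((θ + 2 * Real.pi : ℝ) : ℂ) * Complex.I)) =
        Complex.exp (m * (θ * Complex.I)) :=
      Complex.exp_eq_exp_iff_exists_int.2 ⟨m, by push_cast; ring⟩
    simp only [hp θ, this]
  have he : ∀ k : ℤ, (∫ θ in (0 : ℝ)..2 * Real.pi,
      f θ * Complex.exp (-Complex.I * ((k - m : ℤ) : ℂ) * θ)) =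
      ∫ θ in (0 : ℝ)..2 * Real.pi,
        f θ * Complex.exp (m * (θ * Complex.I)) * Complex.exp (-Complex.I * k * θ) := by
    intro k
    congr 1
    ext θ
    rw [mul_assoc (f θ), ← Complex.exp_add]
    congr 2
    push_cast
    ring
  obtain ⟨C, hC⟩ := exists_norm_integral_mul_exp_le 0 hg hgp
  obtain ⟨D, hD⟩ := exists_norm_integral_mul_exp_le p hg hgp
  -- From `(1 + |k|)^p ≤ 2^{p-1} (1 + |k|^p)`, with the decay bounds of orders `0` and `p`.
  refine ⟨2 ^ (p - 1) * (C + D), fun k => ?_⟩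
  rw [he k]
  have h1 := hC k
  have h2 := hD k
  rw [pow_zero] at h1
  have h3 := add_pow_le (zero_le_one' ℝ) (abs_nonneg (k : ℝ)) p
  rw [one_pow] at h3
  refine (mul_le_mul_of_nonneg_right h3 (norm_nonneg _)).trans ?_
  rw [mul_assoc, add_mul]
  gcongr

theorem xi_contDiff (γ : DiffPlus) (n : ℕ) (hn : 1 ≤ n) (m : ℕ) : ContDiff ℝ ∞ (xi γ n hn m) :=
  (schwarzianRing_aux γ.contDiff_fn γ.zDeriv_fn_ne ((xi_spec γ n hn).1 m)).1

theorem xi_periodic (γ : DiffPlus) (n : ℕ) (hn : 1 ≤ n) (m : ℕ) :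
    Function.Periodic (xi γ n hn m) (2 * Real.pi) :=
  schwarzianRing_periodic γ.periodic_fn ((xi_spec γ n hn).1 m)

theorem alpha_pos (n : ℕ) : 0 < alpha n := by
  unfold alpha
  positivity

theorem c_pos (n : ℕ) (k : ℤ) : 0 < c n k := by
  have := alpha_pos n
  unfold c
  split_ifs <;> positivity

/-- The factor `c[2]_k` undoes the normalisation in `Xi` and leaves a plain Fourier coefficient of
`ξ_m`. Summing the constants over the finitely many `m` makes the bound uniform in `m`. -/
theorem exists_norm_Xi_mul_c_le (γ : DiffPlus) (n : ℕ) (hn : 1 ≤ n) (p : ℕ) :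
    ∃ C : ℝ, 0 ≤ C ∧ ∀ m ∈ Finset.Icc 2 (2 * n - 1), ∀ k : ℤ,
      ‖Xi γ n hn m k * c 2 k‖ ≤ C / (1 + |(k : ℝ)|) ^ p := by
  choose C hC using fun m : ℕ => exists_norm_integral_mul_exp_shift_le
    (xi_contDiff γ n hn m) (xi_periodic γ n hn m) m p
  have hC0 : ∀ m, 0 ≤ C m := fun m => le_trans (by positivity) (hC m 0)
  refine ⟨∑ m ∈ Finset.Icc 2 (2 * n - 1), 1 / (2 * Real.pi) * C m,
    Finset.sum_nonneg fun m _ => mul_nonneg (by positivity) (hC0 m), fun m hm k => ?_⟩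
  have hc : (c 2 k : ℂ) ≠ 0 := by exact_mod_cast (c_pos 2 k).ne'
  have hpi := Real.pi_pos
  rw [Xi, div_mul_cancel₀ _ hc, le_div_iff₀ (by positivity), norm_mul]
  refine le_trans ?_ (Finset.single_le_sum
    (fun i _ => mul_nonneg (by positivity) (hC0 i)) hm : 1 / (2 * Real.pi) * C m ≤ _)
  have h1 : ‖(1 / (2 * Real.pi) : ℂ)‖ = 1 / (2 * Real.pi) := by
    rw [show (1 / (2 * Real.pi) : ℂ) = ((1 / (2 * Real.pi) : ℝ) : ℂ) by push_cast; ring,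
      Complex.norm_real, Real.norm_of_nonneg (by positivity)]
  rw [h1, mul_assoc]
  refine mul_le_mul_of_nonneg_left ?_ (by positivity)
  rw [mul_comm]
  exact hC m k

/-! ### Growth of the weights -/

/-- The factorial quotient `(2n+a-1)!/a!` is a product of `2n-1` consecutive integers, the smallest
being `a+1`. -/
theorem sqrt_pow_le_c (n : ℕ) (hn : 1 ≤ n) (a : ℕ) :
    √(alpha n) * √((a : ℝ) + 1) ^ (2 * n - 1) ≤ c n (n + a) := by
  have h1 : ((n : ℤ) + a).natAbs = n + a := by omega
  have h2 : ((a : ℝ) + 1) ^ (2 * n - 1) ≤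
      ((n + a + n - 1).factorial : ℝ) / (n + a - n).factorial := by
    rw [le_div_iff₀ (by positivity)]
    have h3 := Nat.pow_sub_le_descFactorial (n + a + n - 1) (2 * n - 1)
    have h4 := Nat.factorial_mul_descFactorial (show 2 * n - 1 ≤ n + a + n - 1 by omega)
    rw [show n + a + n - 1 + 1 - (2 * n - 1) = a + 1 by omega] at h3
    rw [show n + a + n - 1 - (2 * n - 1) = n + a - n by omega] at h4
    rw [← h4, mul_comm]
    exact_mod_cast Nat.mul_le_mul_left _ h3
  rw [c, h1, if_pos (by omega)]
  refine mul_le_mul_of_nonneg_left ?_ (Real.sqrt_nonneg _)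
  refine Real.le_sqrt_of_sq_le ?_
  rwa [← pow_mul, mul_comm, pow_mul, Real.sq_sqrt (by positivity)]

theorem cDual_div_c_le (n : ℕ) (hn : 1 ≤ n) (a b : ℕ) :
    cDual n (n + b) / c n (n + a) ≤ 1 / √(((a : ℝ) + 1) * (b + 1)) ^ (2 * n - 1) := by
  have h0 := alpha_pos n
  rw [cDual, div_div, div_le_div_iff₀ (mul_pos (c_pos _ _) (c_pos _ _)) (by positivity), one_mul,
    Real.sqrt_mul (by positivity), mul_pow]
  calc alpha n * (√((a : ℝ) + 1) ^ (2 * n - 1) * √((b : ℝ) + 1) ^ (2 * n - 1))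
      = (√(alpha n) * √((b : ℝ) + 1) ^ (2 * n - 1)) *
        (√(alpha n) * √((a : ℝ) + 1) ^ (2 * n - 1)) := by
        linear_combination (-(√((a : ℝ) + 1) ^ (2 * n - 1) * √((b : ℝ) + 1) ^ (2 * n - 1))) *
          Real.mul_self_sqrt h0.le
    _ ≤ _ := mul_le_mul (sqrt_pow_le_c n hn b) (sqrt_pow_le_c n hn a) (by positivity)
        (c_pos _ _).le

/-- Each factor `b + 2n - 1 - r` lies between `0` and `2n(b+1)`, and `m ≥ 2` leaves at most `2n-3`
of them. This saving of two powers against `2n-1` is what makes the rows and columns summable. -/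
theorem norm_prod_le (n m b : ℕ) (hm : 2 ≤ m) (hmn : m ≤ 2 * n - 1) :
    ‖∏ r ∈ Finset.range (2 * n - 1 - m), ((((n : ℤ) + b : ℤ) : ℂ) + n - 1 - r)‖ ≤
      (2 * n : ℝ) ^ (2 * n - 1) * ((b : ℝ) + 1) ^ (2 * n - 3) := by
  have hn : (1 : ℝ) ≤ n := by exact_mod_cast (by omega : 1 ≤ n)
  have hb : (0 : ℝ) ≤ b := b.cast_nonneg
  calc _ ≤ ∏ r ∈ Finset.range (2 * n - 1 - m), (2 * n * ((b : ℝ) + 1)) := by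
        rw [norm_prod]
        refine Finset.prod_le_prod (fun _ _ => norm_nonneg _) fun r hr => ?_
        have hr' : r + 1 ≤ 2 * n := by have := Finset.mem_range.1 hr; omega
        have hr2 : (r : ℝ) + 1 ≤ 2 * n := by exact_mod_cast hr'
        have hr0 : (0 : ℝ) ≤ r := r.cast_nonneg
        rw [show (((n : ℤ) + b : ℤ) : ℂ) + n - 1 - r = ((b + 2 * n - 1 - r : ℝ) : ℂ) by
          push_cast; ring, Complex.norm_real, Real.norm_of_nonneg (by linarith)]
        nlinarith
    _ = (2 * n : ℝ) ^ (2 * n - 1 - m) * ((b : ℝ) + 1) ^ (2 * n - 1 - m) := by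
        rw [Finset.prod_const, Finset.card_range, mul_pow]
    _ ≤ _ := mul_le_mul (pow_le_pow_right₀ (by linarith) (by omega))
        (pow_le_pow_right₀ (by linarith) (by omega)) (by positivity) (by positivity)

/-- Since `y ≤ (1+|x-y|) x`, the geometric mean satisfies `y ≤ (1+|x-y|) √(xy)`. Raising this to the
power `2n-1` trades `√(xy)` for `y` at the cost of powers of the distance to the diagonal. -/
theorem pow_div_sqrt_pow_le (n : ℕ) (hn : 2 ≤ n) {x y : ℝ} (hx : 1 ≤ x) (hy : 1 ≤ y) :
    y ^ (2 * n - 3) * (1 / √(x * y) ^ (2 * n - 1)) ≤ (1 + |x - y|) ^ (2 * n - 1) / y ^ 2 := by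
  have h0 : 0 < x * y := by positivity
  have h1 : y ≤ (1 + |x - y|) * √(x * y) := by
    refine le_of_sq_le_sq ?_ (by positivity)
    rw [mul_pow, Real.sq_sqrt h0.le]
    have h2 : y ≤ (1 + |x - y|) * x := by
      have := neg_abs_le (x - y)
      nlinarith [abs_nonneg (x - y)]
    have h3 : (1 + |x - y|) ≤ (1 + |x - y|) ^ 2 := by nlinarith [abs_nonneg (x - y)]
    calc y ^ 2 = y * y := sq y
      _ ≤ (1 + |x - y|) * x * y := by gcongr
      _ = (1 + |x - y|) * (x * y) := mul_assoc _ _ _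
      _ ≤ _ := by gcongr
  rw [mul_one_div, div_le_div_iff₀ (by positivity) (by positivity), ← pow_add,
    show 2 * n - 3 + 2 = 2 * n - 1 by omega, ← mul_pow]
  gcongr

/-! ### Summability of the matrix entries -/

theorem exists_norm_frakS₁_le (γ : DiffPlus) (n : ℕ) (hn : 2 ≤ n) :
    ∃ C : ℝ, ∀ l j : {k : ℤ // (n : ℤ) ≤ k}, ‖frakS₁ γ n (by omega) l j‖ ≤
      C * (1 / (1 + |((l - j : ℤ) : ℝ)|) ^ 2 * (1 / (1 + |((j - n : ℤ) : ℝ)|) ^ 2)) := by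
  -- Of these powers of decay, `2n-1` pay for the loss in `pow_div_sqrt_pow_le`; the other two give
  -- summability in `l - j`.
  obtain ⟨C, hC0, hC⟩ := exists_norm_Xi_mul_c_le γ n (by omega) (2 * n - 1 + 2)
  refine ⟨∑ m ∈ Finset.Icc 2 (2 * n - 1), C * (2 * n : ℝ) ^ (2 * n - 1), ?_⟩
  rintro ⟨l, hl⟩ ⟨j, hj⟩
  obtain ⟨a, rfl⟩ := Int.le.dest hl
  obtain ⟨b, rfl⟩ := Int.le.dest hj
  simp only [frakS₁, Matrix.submatrix_apply, frakS]
  have hsgn : sgn n (n + b) = 1 := if_pos hj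
  rw [hsgn, one_mul, Finset.sum_mul]
  refine norm_sum_le_of_le _ fun m hm => ?_
  obtain ⟨hm2, hmn⟩ := Finset.mem_Icc.1 hm
  have hd : (((n + a : ℤ) - (n + b : ℤ) : ℤ) : ℝ) = ((a : ℝ) + 1) - (b + 1) := by push_cast; ring
  have hjn : (((n + b : ℤ) - n : ℤ) : ℝ) = b := by push_cast; ring
  have h1 := hC m hm ((n + a : ℤ) - (n + b : ℤ))
  have h2 := cDual_div_c_le n (by omega) a b
  have h3 := norm_prod_le n m b hm2 hmn
  have h4 := pow_div_sqrt_pow_le n hn (x := (a : ℝ) + 1) (y := (b : ℝ) + 1) (by simp) (by simp)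
  have h5 : 0 ≤ cDual n (n + b) / c n (n + a) :=
    div_nonneg (div_nonneg (alpha_pos n).le (c_pos _ _).le) (c_pos _ _).le
  rw [hd] at h1 ⊢
  rw [hjn, abs_of_nonneg (b.cast_nonneg : (0 : ℝ) ≤ b), mul_div_assoc, ← mul_assoc, norm_mul, norm_mul,
    ← Complex.ofReal_div, Complex.norm_real, Real.norm_of_nonneg h5]
  set u : ℝ := 1 + |(a : ℝ) + 1 - (b + 1)| with hu
  have hu0 : 0 < u := by positivity
  calc _ ≤ C / u ^ (2 * n - 1 + 2) * (1 / √(((a : ℝ) + 1) * (b + 1)) ^ (2 * n - 1)) *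
        ((2 * n : ℝ) ^ (2 * n - 1) * ((b : ℝ) + 1) ^ (2 * n - 3)) := by gcongr
    _ = C / u ^ (2 * n - 1 + 2) * (2 * n : ℝ) ^ (2 * n - 1) * (((b : ℝ) + 1) ^ (2 * n - 3) *
        (1 / √(((a : ℝ) + 1) * (b + 1)) ^ (2 * n - 1))) := by ring
    _ ≤ C / u ^ (2 * n - 1 + 2) * (2 * n : ℝ) ^ (2 * n - 1) *
        (u ^ (2 * n - 1) / ((b : ℝ) + 1) ^ 2) := by gcongr
    _ = _ := by
      rw [pow_add, add_comm (b : ℝ) 1]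
      field_simp

theorem summable_one_div_one_add_abs_int_sq :
    Summable fun k : ℤ => 1 / (1 + |(k : ℝ)|) ^ 2 := by
  have h := (summable_nat_add_iff 1).2 (Real.summable_one_div_nat_pow.2 one_lt_two)
  refine .of_nat_of_neg ?_ ?_ <;>
  · refine h.congr fun k => ?_
    simp [add_comm]

theorem summable_norm_frakS₁ (γ : DiffPlus) (n : ℕ) (hn : 2 ≤ n) :
    Summable fun p : {k : ℤ // (n : ℤ) ≤ k} × {k : ℤ // (n : ℤ) ≤ k} =>
      ‖frakS₁ γ n (by omega) p.1 p.2‖ := by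
  obtain ⟨C, hC⟩ := exists_norm_frakS₁_le γ n hn
  have hs := summable_one_div_one_add_abs_int_sq
  have h := hs.mul_of_nonneg hs (fun _ => by positivity) (fun _ => by positivity)
  -- In the coordinates `(l - j, j - n)` the bound is a product of two summable functions on `ℤ`.
  have hinj : Function.Injective
      fun p : {k : ℤ // (n : ℤ) ≤ k} × {k : ℤ // (n : ℤ) ≤ k} =>
        ((p.1 - p.2 : ℤ), (p.2 - n : ℤ)) := by
    rintro ⟨⟨a, _⟩, ⟨b, _⟩⟩ ⟨⟨a', _⟩, ⟨b', _⟩⟩ hab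
    simp only [Prod.mk.injEq, Subtype.mk.injEq] at hab ⊢
    omega
  exact .of_nonneg_of_le (fun _ => norm_nonneg _) (fun p => hC p.1 p.2)
    ((h.comp_injective hinj).mul_left C)

/-- The range `2 ≤ m ≤ 2n-1` is empty for `n = 1`. -/
theorem frakS₁_one (γ : DiffPlus) : frakS₁ γ 1 le_rfl = 0 := by
  ext l j
  simp [frakS₁, frakS]

end CircleSchwarzian

theorem mainTheorem8 (γ : CircleSchwarzian.DiffPlus) (n : ℕ) (hn : 1 ≤ n) :
    CircleSchwarzian.DefinesTraceClass (CircleSchwarzian.frakS₁ γ n hn) := by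
  refine CircleSchwarzian.definesTraceClass_of_summable ?_
  obtain rfl | h := hn.eq_or_lt
  · simp [CircleSchwarzian.frakS₁_one, summable_zero]
  · exact CircleSchwarzian.summable_norm_frakS₁ γ n h
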